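/- Let $(\mathcal R,\mu)$ be a $\sigma$-finite measure space. Write $\mathcal M$ for the set of ($\mu$-a.e. classes of) extended complex-valued measurable functions on $\mathcal R$ and $\mathcal M_+$ for its non-negative elements. For $f\in\mathcal M$ put $f_*(s)=\mu(\{x:|f(x)|>s\})$ for $s\in[0,\infty)$ and $f^*(t)=\inf\{s\in[0,\infty): f_*(s)\le t\}$ for $t\in[0,\infty)$ (with $\inf\emptyset=\infty$), and call $f,g\in\mathcal M$ equimeasurable if $f^*=g^*$. Assume that $(\mathcal R,\mu)$ is resonant, i.e. that for all $f,g\in\mathcal M$ $$\sup\Big\{\int_{\mathcal R}|f\tilde g|\,d\mu \;:\; \tilde g\in\mathcal M,\ \tilde g^*=g^*\Big\}=\int_0^\infty f^*(t)g^*(t)\,dt .$$ A rearrangement-invariant (r.i.) quasi-Banach function norm is a map $\|\cdot\|:\mathcal M\to[0,\infty]$ with $\|\,|f|\,\|=\|f\|$ for all $f \in \mathcal M$ and $\|f\|=\|g\|$ for equimeasurable $f,g\in\mathcal M$, such that on $\mathcal M_+$: $\|af\|=|a|\,\|f\|$ for $a\in\mathbb C$; $\|f\|=0$ if and only if $f=0$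 a.e.; there is $C\ge1$ with $\|f+g\|\le C(\|f\|+\|g\|)$ for all $f,g$; $f\le g$ a.e. implies $\|f\|\le\|g\|$; $f_n\uparrow f$ a.e. implies $\|f_n\|\uparrow\|f\|$; and $\|\chi_E\|<\infty$ whenever $\mu(E)<\infty$. The corresponding r.i. quasi-Banach function space is $X=\{f\in\mathcal M:\|f\|<\infty\}$. Let $\phi:\mathcal R\to\mathcal R$ be measurable and let $T_\phi f=f\circ\phi$. For a space $X$ as above, "$T_\phi:X\to X$ is power-bounded" means that $T_\phi$ is a well-defined map (on a.e. classes) from $X$ to $X$ and that the set of its iterates $\{T_\phi^n:n\in\mathbb N\}$ is equicontinuous with respect to the quasinorm topology of $X$. Then the following three statements are equivalent: 1. $\phi$ is power-measure-bounded, i.e. there is $A\in(0,\infty)$ such that $\mu(\phi^{-n}(E))\le A\,\mu(E)$ for every $n\ge1$ and every measurable $E\subseteq\mathcal R$, where $\phi^{-n}(E)$ is the preimage of $E$ under the $n$-fold composition $\phi^n$; 2. $T_\phi:L^1(\mathcal R,\mu)\to L^1(\mathcal R,\mu)$ is power-bounded; 3. $T_\phi:X\to X$ is power-bounded for every r.i.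 quasi-Banach function space $X$ over $(\mathcal R,\mu)$. -/

import Mathlib

open MeasureTheory Filter Topology
open scoped NNReal ENNReal

noncomputable section

namespace RISpace

variable {α : Type*} [MeasurableSpace α]

/-- The distribution function `f_*(s) = μ {x | f x > s}` of a non-negative extended function.
For a complex function `g` it is applied to the modulus `x ↦ ‖g x‖ₑ`. -/
def distribution (μ : Measure α) (f : α → ℝ≥0∞) (s : ℝ≥0) : ℝ≥0∞ :=
  μ {x | (s : ℝ≥0∞) < f x}

/-- The non-increasing rearrangement `f^*(t) = inf {s ∈ [0, ∞) | f_*(s) ≤ t}`, with the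
infimum of the empty set equal to `∞`. -/
def rearrangement (μ : Measure α) (f : α → ℝ≥0∞) (t : ℝ≥0) : ℝ≥0∞ :=
  ⨅ (s : ℝ≥0) (_ : distribution μ f s ≤ t), (s : ℝ≥0∞)

/-- Two functions are equimeasurable if their non-increasing rearrangements agree. -/
def Equimeasurable (μ : Measure α) (f g : α → ℝ≥0∞) : Prop :=
  rearrangement μ f = rearrangement μ g

/-- A measure is resonant if the Hardy–Littlewood inequality is saturated: the supremum of
`∫ f g̃ dμ` over all `g̃` equimeasurable with `g` is `∫₀^∞ f^* g^* dλ`. Since only moduli of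
functions occur, it is stated for non-negative extended functions. -/
def Resonant (μ : Measure α) : Prop :=
  ∀ f g : α → ℝ≥0∞, Measurable f → Measurable g →
    (⨆ (h : α → ℝ≥0∞) (_ : Measurable h) (_ : Equimeasurable μ h g), ∫⁻ x, f x * h x ∂μ) =
      ∫⁻ t in Set.Ici (0 : ℝ), rearrangement μ f t.toNNReal * rearrangement μ g t.toNNReal

/-- Rearrangement-invariant quasi-Banach function norms. Such a functional satisfies
`‖|f|‖ = ‖f‖`, so it is given by its values on non-negative extended measurable functions;
values on non-measurable functions play no role. By `mono` it only depends on the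
almost everywhere class of a function. -/
structure IsRIQuasiBanachFunctionNorm (μ : Measure α) (ρ : (α → ℝ≥0∞) → ℝ≥0∞) : Prop where
  homogeneous : ∀ (a : ℝ≥0) (f : α → ℝ≥0∞), Measurable f →
    ρ (fun x => (a : ℝ≥0∞) * f x) = (a : ℝ≥0∞) * ρ f
  eq_zero_iff : ∀ f : α → ℝ≥0∞, Measurable f → (ρ f = 0 ↔ f =ᵐ[μ] 0)
  quasi_subadditive : ∃ C : ℝ≥0, 1 ≤ C ∧ ∀ f g : α → ℝ≥0∞, Measurable f → Measurable g →
    ρ (fun x => f x + g x) ≤ (C : ℝ≥0∞) * (ρ f + ρ g)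
  mono : ∀ f g : α → ℝ≥0∞, Measurable f → Measurable g → f ≤ᵐ[μ] g → ρ f ≤ ρ g
  fatou : ∀ (F : ℕ → α → ℝ≥0∞) (f : α → ℝ≥0∞), (∀ n, Measurable (F n)) → Measurable f →
    (∀ᵐ x ∂μ, Monotone (fun n => F n x) ∧ Tendsto (fun n => F n x) atTop (𝓝 (f x))) →
    Tendsto (fun n => ρ (F n)) atTop (𝓝 (ρ f))
  indicator_lt_top : ∀ E : Set α, MeasurableSet E → μ E < ∞ →
    ρ (E.indicator (fun _ => 1)) < ∞
  rearrangement_invariant : ∀ f g : α → ℝ≥0∞, Measurable f → Measurable g →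
    Equimeasurable μ f g → ρ f = ρ g

/-- The functional `ρ`, applied to the modulus of an a.e. class of complex functions. -/
def fnorm {μ : Measure α} (ρ : (α → ℝ≥0∞) → ℝ≥0∞) (f : α →ₘ[μ] ℂ) : ℝ≥0∞ :=
  ρ (fun x => ‖f x‖ₑ)

/-- The function space of `ρ`: all classes of measurable functions with `‖f‖ < ∞`. (A function
with finite quasinorm is finite almost everywhere, so complex-valued functions suffice.) -/
def space (μ : Measure α) (ρ : (α → ℝ≥0∞) → ℝ≥0∞) : Set (α →ₘ[μ] ℂ) :=
  {f | fnorm ρ f < ∞}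

/-- `T` is the composition operator `f ↦ f ∘ φ` on the space of `ρ`: whichever measurable
representative `f` of a class `F` is chosen, `f ∘ φ` represents `T F`. The existence of such a
`T` says that composition with `φ` is well defined on classes and maps the space to itself. -/
def IsCompositionOperator (μ : Measure α) (ρ : (α → ℝ≥0∞) → ℝ≥0∞) (φ : α → α)
    (T : space μ ρ → space μ ρ) : Prop :=
  ∀ (F : space μ ρ) (f : α → ℂ), Measurable f → (F : α →ₘ[μ] ℂ) =ᵐ[μ] f →
    (T F : α →ₘ[μ] ℂ) =ᵐ[μ] f ∘ φ

/-- The iterates `T^n`, `n ∈ ℕ`, are equicontinuous for the quasinorm topology. -/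
def PowerBounded (μ : Measure α) (ρ : (α → ℝ≥0∞) → ℝ≥0∞)
    (T : space μ ρ → space μ ρ) : Prop :=
  ∀ f : space μ ρ, ∀ ε : ℝ≥0∞, 0 < ε → ∃ δ : ℝ≥0∞, 0 < δ ∧
    ∀ g : space μ ρ, fnorm ρ ((g : α →ₘ[μ] ℂ) - (f : α →ₘ[μ] ℂ)) < δ →
      ∀ n : ℕ, fnorm ρ ((T^[n] g : α →ₘ[μ] ℂ) - (T^[n] f : α →ₘ[μ] ℂ)) < ε

/-- `T_φ : X → X` is (well defined and) power-bounded, where `X` is the space of `ρ`. -/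
def CompositionPowerBounded (μ : Measure α) (ρ : (α → ℝ≥0∞) → ℝ≥0∞) (φ : α → α) : Prop :=
  ∃ T : space μ ρ → space μ ρ, IsCompositionOperator μ ρ φ T ∧ PowerBounded μ ρ T

/-- The functional `f ↦ ∫ f dμ`, whose space is `L¹`. -/
def L1norm (μ : Measure α) (f : α → ℝ≥0∞) : ℝ≥0∞ :=
  ∫⁻ x, f x ∂μ

/-- There is `A ∈ (0, ∞)` with `μ (φ^{-n}(E)) ≤ A μ(E)` for all `n ≥ 1` and measurable `E`. -/
def PowerMeasureBounded (μ : Measure α) (φ : α → α) : Prop :=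
  ∃ A : ℝ≥0, 0 < A ∧ ∀ n : ℕ, 1 ≤ n → ∀ E : Set α, MeasurableSet E →
    μ (φ^[n] ⁻¹' E) ≤ (A : ℝ≥0∞) * μ E

end RISpace

end

/-! The substance is 1 → 3. Let `μ (ψ⁻¹ E) ≤ (N + 1) μ E` for all `E`, and let `s` be simple with
nonzero values on sets of finite measure. Each level set of `s ∘ ψ` is at most `N + 1` times as
large as that of `s`, so it is covered by `N + 1` pieces, each as large as some subset of the latter
(`Resonant.exists_pieces`). Hence `s ∘ ψ` is at most a sum of `N + 1` functions, each equimeasurable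
with a function below `s`. Invariance and the quasi-triangle inequality bound `ρ (s ∘ ψ)` by `K * ρ
s`, with `K` independent of `ψ`; the Fatou property extends this to all functions, and `ψ = φ^[n]`
gives equicontinuity.

Cutting out pieces of prescribed measure is where resonance enters
(`Resonant.exists_subset_measure_eq`): the space may have atoms, but sets can still be matched in
measure.

For 3 → 2, resonance against the constant 1 shows that the integral depends only on the
rearrangement. For 2 → 1, equicontinuity at 0 is tested on multiples of indicators. -/

namespace RISpace

variable {α : Type*}

/-! ### Step functions -/

/-- The function with value `y` on `A y` for `y ∈ Y`, for disjoint sets `A y`. -/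
noncomputable def stepFunction (Y : Finset ℝ≥0∞) (A : ℝ≥0∞ → Set α) (x : α) : ℝ≥0∞ :=
  ∑ y ∈ Y, (A y).indicator (fun _ => y) x

lemma stepFunction_of_mem {Y : Finset ℝ≥0∞} {A : ℝ≥0∞ → Set α} {s : α → ℝ≥0∞}
    (hs : ∀ y ∈ Y, ∀ x ∈ A y, s x = y) {x : α} {y : ℝ≥0∞} (hy : y ∈ Y) (hx : x ∈ A y) :
    stepFunction Y A x = y := by
  unfold stepFunction
  rw [Finset.sum_eq_single y]
  · simp [hx]
  · intro z hz hzy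
    refine Set.indicator_of_notMem (fun hxz => hzy ?_) _
    rw [← hs z hz x hxz, hs y hy x hx]
  · exact fun h => absurd hy h

lemma stepFunction_of_notMem {Y : Finset ℝ≥0∞} {A : ℝ≥0∞ → Set α} {x : α}
    (hx : ∀ y ∈ Y, x ∉ A y) : stepFunction Y A x = 0 :=
  Finset.sum_eq_zero fun y hy => Set.indicator_of_notMem (hx y hy) _

lemma stepFunction_le {Y : Finset ℝ≥0∞} {A : ℝ≥0∞ → Set α} {s : α → ℝ≥0∞}
    (hs : ∀ y ∈ Y, ∀ x ∈ A y, s x = y) (x : α) : stepFunction Y A x ≤ s x := by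
  by_cases h : ∃ y ∈ Y, x ∈ A y
  · obtain ⟨y, hy, hx⟩ := h
    rw [stepFunction_of_mem hs hy hx, hs y hy x hx]
  · push Not at h
    simp [stepFunction_of_notMem h]

variable [MeasurableSpace α] {μ : Measure α}

/-! ### Distributions and rearrangements -/

lemma distribution_anti (μ : Measure α) (f : α → ℝ≥0∞) : Antitone (distribution μ f) := by
  intro s t hst
  refine measure_mono fun x hx => ?_
  have hx' : (t : ℝ≥0∞) < f x := hx
  exact lt_of_le_of_lt (by exact_mod_cast hst) hx'

/-- The infimum defining the rearrangement is attained because the distribution function is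
right-continuous, by continuity of `μ` from below. Thus the rearrangement determines the
distribution. -/
lemma rearrangement_le_iff (μ : Measure α) (f : α → ℝ≥0∞) (s t : ℝ≥0) :
    rearrangement μ f t ≤ s ↔ distribution μ f s ≤ t := by
  constructor
  · intro h
    have key : ∀ s' : ℝ≥0, s < s' → distribution μ f s' ≤ t := by
      intro s' hs'
      have h1 : rearrangement μ f t < s' := lt_of_le_of_lt h (by exact_mod_cast hs')
      unfold rearrangement at h1
      simp only [iInf_lt_iff] at h1
      obtain ⟨r, hr, hrs⟩ := h1
      exact (distribution_anti μ f (by exact_mod_cast hrs.le)).trans hr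
    obtain ⟨u, hu, hus, hlim⟩ := exists_seq_strictAnti_tendsto s
    have hset : {x | (s : ℝ≥0∞) < f x} = ⋃ n, {x | (u n : ℝ≥0∞) < f x} := by
      ext x
      simp only [Set.mem_ofPred_eq, Set.mem_iUnion]
      constructor
      · intro hx
        have : Tendsto (fun n => (u n : ℝ≥0∞)) atTop (𝓝 s) := ENNReal.tendsto_coe.2 hlim
        exact (this.eventually_lt_const hx).exists
      · rintro ⟨n, hn⟩
        exact lt_trans (by exact_mod_cast hus n) hn
    unfold distribution
    rw [hset, Monotone.measure_iUnion]
    · exact iSup_le fun n => key _ (hus n)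
    · intro m n hmn x hx
      have hx' : (u m : ℝ≥0∞) < f x := hx
      exact lt_of_le_of_lt (by exact_mod_cast hu.antitone hmn) hx'
  · intro h
    exact iInf₂_le s h

lemma equimeasurable_iff {f g : α → ℝ≥0∞} :
    Equimeasurable μ f g ↔ ∀ s, distribution μ f s = distribution μ g s := by
  constructor
  · intro h s
    refine ENNReal.eq_of_forall_le_nnreal_iff fun t => ?_
    rw [← rearrangement_le_iff, ← rearrangement_le_iff, h]
  · intro h
    funext t
    simp only [rearrangement, h]

lemma distribution_indicator_one (E : Set α) (s : ℝ≥0) :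
    distribution μ (E.indicator fun _ => 1) s = if s < 1 then μ E else 0 := by
  unfold distribution
  split_ifs with hs
  · congr 1
    ext x
    by_cases hx : x ∈ E <;> simp [hx, hs]
  · convert measure_empty (μ := μ)
    ext x
    by_cases hx : x ∈ E
    · simpa [hx] using hs
    · simp [hx]

lemma rearrangement_indicator_one (E : Set α) (t : ℝ≥0) :
    rearrangement μ (E.indicator fun _ => 1) t = if (t : ℝ≥0∞) < μ E then 1 else 0 := by
  refine ENNReal.eq_of_forall_le_nnreal_iff fun s => ?_
  rw [rearrangement_le_iff, distribution_indicator_one]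
  rcases lt_or_ge s 1 with hs | hs <;> rcases lt_or_ge (t : ℝ≥0∞) (μ E) with ht | ht <;>
    simp [hs, ht, not_lt.2, not_le.2]

lemma Equimeasurable.of_indicator_one {h : α → ℝ≥0∞} {E : Set α}
    (hh : Equimeasurable μ h (E.indicator fun _ => 1)) :
    μ {x | 0 < h x} = μ E ∧ h ≤ᵐ[μ] fun _ => 1 := by
  rw [equimeasurable_iff] at hh
  simp only [distribution_indicator_one] at hh
  constructor
  · simpa [distribution] using hh 0
  · have := hh 1
    simp only [lt_self_iff_false, if_false, distribution, ENNReal.coe_one] at this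
    rw [Filter.EventuallyLE, ae_iff]
    simpa using this

/-- The rearrangement of an indicator is the indicator of `[0, μ E)`, so the product is the factor
of the smaller set. -/
lemma lintegral_rearrangement_indicator_mul {E F : Set α} (hEF : μ E ≤ μ F) :
    ∫⁻ t in Set.Ici (0 : ℝ), rearrangement μ (F.indicator fun _ => 1) t.toNNReal *
      rearrangement μ (E.indicator fun _ => 1) t.toNNReal = μ E := by
  have hset : ∀ t : ℝ, rearrangement μ (F.indicator fun _ => 1) t.toNNReal *
      rearrangement μ (E.indicator fun _ => 1) t.toNNReal =
      {t : ℝ | ENNReal.ofReal t < μ E}.indicator (fun _ => 1) t := by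
    intro t
    rw [rearrangement_indicator_one, rearrangement_indicator_one]
    by_cases h : ENNReal.ofReal t < μ E
    · have h' : ENNReal.ofReal t < μ F := h.trans_le hEF
      simp only [ENNReal.ofReal] at h h'
      simp [h, h', ENNReal.ofReal]
    · simp only [ENNReal.ofReal] at h
      simp [h, ENNReal.ofReal]
  have hm : MeasurableSet {t : ℝ | ENNReal.ofReal t < μ E} :=
    measurableSet_lt ENNReal.measurable_ofReal measurable_const
  simp only [hset]
  rw [lintegral_indicator_const hm, one_mul, Measure.restrict_apply hm]
  rcases eq_or_ne (μ E) ∞ with h | h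
  · simp [h]
  · have : {t : ℝ | ENNReal.ofReal t < μ E} ∩ Set.Ici 0 = Set.Ico 0 (μ E).toReal := by
      ext t
      simp only [Set.mem_inter_iff, Set.mem_ofPred_eq, Set.mem_Ici, Set.mem_Ico]
      constructor
      · rintro ⟨h1, h2⟩
        exact ⟨h2, (ENNReal.ofReal_lt_iff_lt_toReal h2 h).1 h1⟩
      · rintro ⟨h2, h1⟩
        exact ⟨(ENNReal.ofReal_lt_iff_lt_toReal h2 h).2 h1, h2⟩
    rw [this, Real.volume_Ico, sub_zero, ENNReal.ofReal_toReal h]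

/-! ### Subsets of prescribed measure in resonant spaces -/

/-- Half of the measure of `E` can be fitted into `F`, and what is missing is again the measure
of a set. -/
lemma Resonant.exists_subset_half (hμ : Resonant μ) {E F : Set α} (hE : MeasurableSet E)
    (hF : MeasurableSet F) (hEtop : μ E ≠ ∞) (hEF : μ E ≤ μ F) :
    ∃ F' E' : Set α, MeasurableSet F' ∧ MeasurableSet E' ∧ F' ⊆ F ∧ μ F' + μ E' = μ E ∧
      μ E' ≤ μ E / 2 := by
  rcases eq_or_ne (μ E) 0 with h0 | h0
  · exact ⟨∅, ∅, by simp, by simp, by simp, by simp [h0], by simp⟩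
  have hsup := hμ (F.indicator fun _ => 1) (E.indicator fun _ => 1)
    (measurable_const.indicator hF) (measurable_const.indicator hE)
  rw [lintegral_rearrangement_indicator_mul hEF] at hsup
  -- Any `h` beating half the supremum has more than half of its support inside `F`.
  have hlt : μ E / 2 < ⨆ (h : α → ℝ≥0∞) (_ : Measurable h)
      (_ : Equimeasurable μ h (E.indicator fun _ => 1)),
      ∫⁻ x, F.indicator (fun _ => 1) x * h x ∂μ := by
    rw [hsup]
    exact ENNReal.half_lt_self h0 hEtop
  simp only [lt_iSup_iff] at hlt
  obtain ⟨h, hm, heq, hlt⟩ := hlt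
  obtain ⟨hpos, hle⟩ := heq.of_indicator_one
  have hS : MeasurableSet {x | 0 < h x} := measurableSet_lt measurable_const hm
  have hmeas : ∫⁻ x, F.indicator (fun _ => 1) x * h x ∂μ ≤ μ ({x | 0 < h x} ∩ F) := by
    rw [← lintegral_indicator_one (hS.inter hF)]
    refine lintegral_mono_ae ?_
    filter_upwards [hle] with x hx
    by_cases hxF : x ∈ F
    · by_cases hx0 : 0 < h x
      · simpa [hxF, hx0] using hx
      · simp only [not_lt, nonpos_iff_eq_zero] at hx0
        simp [hx0]
    · simp [hxF]
  have hadd : μ ({x | 0 < h x} ∩ F) + μ ({x | 0 < h x} \ F) = μ E := by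
    rw [measure_inter_add_sdiff _ hF, hpos]
  -- The missing measure is that of the support of `h` outside `F`; being carried by a set, it can
  -- be fed to resonance again.
  refine ⟨{x | 0 < h x} ∩ F, {x | 0 < h x} \ F, hS.inter hF, hS.diff hF,
    Set.inter_subset_right, hadd, ?_⟩
  by_contra! hcon
  have := ENNReal.add_lt_add (hlt.trans_le hmeas) hcon
  rw [ENNReal.add_halves, hadd] at this
  exact lt_irrefl _ this

/-- Fitting half of the missing measure into what is left of `F`, again and again, makes the deficit
tend to 0, so the union of the fitted sets has exactly the required measure. -/
lemma Resonant.exists_subset_measure_eq (hμ : Resonant μ) {E F : Set α} (hE : MeasurableSet E)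
    (hF : MeasurableSet F) (hEtop : μ E ≠ ∞) (hEF : μ E ≤ μ F) :
    ∃ F' : Set α, MeasurableSet F' ∧ F' ⊆ F ∧ μ F' = μ E := by
  -- A state is a subset `p.1` of `F` together with a set `p.2` of the missing measure.
  let S := {p : Set α × Set α // MeasurableSet p.1 ∧ MeasurableSet p.2 ∧ p.1 ⊆ F ∧
    μ p.1 + μ p.2 = μ E}
  have hstep : ∀ p : S, ∃ q : S, p.1.1 ⊆ q.1.1 ∧ μ q.1.2 ≤ μ p.1.2 / 2 := by
    rintro ⟨⟨G, D⟩, hG, hD, hGF, hsum⟩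
    have hGtop : μ G ≠ ∞ := ne_top_of_le_ne_top hEtop (hsum ▸ le_self_add)
    have hDtop : μ D ≠ ∞ := ne_top_of_le_ne_top hEtop (hsum ▸ le_add_self)
    have hDF : μ D ≤ μ (F \ G) := by
      rw [measure_sdiff hGF hG.nullMeasurableSet hGtop]
      refine ENNReal.le_sub_of_add_le_left hGtop ?_
      rw [hsum]
      exact hEF
    obtain ⟨G', D', hG', hD', hGF', hsum', hhalf⟩ :=
      hμ.exists_subset_half hD (hF.diff hG) hDtop hDF
    refine ⟨⟨⟨G ∪ G', D'⟩, hG.union hG', hD', Set.union_subset hGF (hGF'.trans Set.sdiff_subset),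
      ?_⟩, Set.subset_union_left, hhalf⟩
    have hdisj : Disjoint G G' := Set.disjoint_left.2 fun x hx hx' => (hGF' hx').2 hx
    simp only
    rw [measure_union hdisj hG', add_assoc, hsum', hsum]
  choose next hnext_sub hnext_half using hstep
  let start : S := ⟨⟨∅, E⟩, MeasurableSet.empty, hE, Set.empty_subset _, by simp⟩
  let u : ℕ → S := fun n => next^[n] start
  have hu : ∀ n, u (n + 1) = next (u n) := fun n => Function.iterate_succ_apply' _ _ _
  have hmono : Monotone fun n => (u n).1.1 := by
    refine monotone_nat_of_le_succ fun n => ?_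
    rw [hu]
    exact hnext_sub _
  have hres : ∀ n, μ (u n).1.2 ≤ μ E * (1 / 2) ^ n := by
    intro n
    induction n with
    | zero => simp [u, start]
    | succ n ih =>
      rw [hu]
      refine (hnext_half _).trans ?_
      rw [pow_succ, ← mul_assoc, ENNReal.div_eq_inv_mul, mul_comm, one_div]
      rw [one_div] at ih
      gcongr
  have hres0 : Tendsto (fun n => μ (u n).1.2) atTop (𝓝 0) := by
    refine tendsto_of_tendsto_of_tendsto_of_le_of_le tendsto_const_nhds ?_
      (fun _ => zero_le) hres
    have h := ENNReal.tendsto_pow_atTop_nhds_zero_of_lt_one (r := 1 / 2) (by simp)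
    simpa using ENNReal.Tendsto.const_mul h (Or.inr hEtop)
  refine ⟨⋃ n, (u n).1.1, MeasurableSet.iUnion fun n => (u n).2.1,
    Set.iUnion_subset fun n => (u n).2.2.2.1, ?_⟩
  have h1 : Tendsto (fun n => μ (u n).1.1) atTop (𝓝 (μ (⋃ n, (u n).1.1))) :=
    tendsto_measure_iUnion_atTop hmono
  have h2 := h1.add hres0
  simp only [fun n => (u n).2.2.2.2, add_zero] at h2
  exact tendsto_nhds_unique h2 tendsto_const_nhds

/-- A set `F` with `μ F ≤ (N + 1) μ E` is covered by `N + 1` subsets, each of the same measure as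
some subset of `E`. -/
lemma Resonant.exists_pieces (hμ : Resonant μ) {E : Set α} (hE : MeasurableSet E)
    (hEtop : μ E ≠ ∞) (N : ℕ) : ∀ F : Set α, MeasurableSet F → μ F ≤ (N + 1 : ℕ) * μ E →
    ∃ P Q : ℕ → Set α, (∀ i, MeasurableSet (P i)) ∧ (∀ i, MeasurableSet (Q i)) ∧
      (∀ i, P i ⊆ F) ∧ (∀ i, Q i ⊆ E) ∧ (∀ i, μ (P i) = μ (Q i)) ∧
      ∀ x ∈ F, ∃ i < N + 1, x ∈ P i := by
  -- If `F` is no larger than `E`, then `F` itself can serve as every piece: pieces may overlap,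
  -- only covering matters.
  have hsmall : ∀ F : Set α, MeasurableSet F → μ F ≤ μ E → ∀ N : ℕ,
      ∃ P Q : ℕ → Set α, (∀ i, MeasurableSet (P i)) ∧ (∀ i, MeasurableSet (Q i)) ∧
      (∀ i, P i ⊆ F) ∧ (∀ i, Q i ⊆ E) ∧ (∀ i, μ (P i) = μ (Q i)) ∧
      ∀ x ∈ F, ∃ i < N + 1, x ∈ P i := by
    intro F hF hFE N
    obtain ⟨E', hE', hE'E, hμE'⟩ :=
      hμ.exists_subset_measure_eq hF hE (ne_top_of_le_ne_top hEtop hFE) hFE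
    exact ⟨fun _ => F, fun _ => E', fun _ => hF, fun _ => hE', fun _ => subset_rfl,
      fun _ => hE'E, fun _ => hμE'.symm, fun x hx => ⟨0, by omega, hx⟩⟩
  induction N with
  | zero =>
    intro F hF hFE
    exact hsmall F hF (by simpa using hFE) 0
  | succ N ih =>
    intro F hF hFE
    rcases le_total (μ F) (μ E) with h | h
    · exact hsmall F hF h _
    -- A copy of `E` is cut off `F`, which lowers the bound on the rest by one multiple of `μ E`.
    obtain ⟨G, hG, hGF, hμG⟩ := hμ.exists_subset_measure_eq hE hF hEtop h
    have hrest : μ (F \ G) ≤ (N + 1 : ℕ) * μ E := by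
      rw [measure_sdiff hGF hG.nullMeasurableSet (hμG ▸ hEtop), hμG, tsub_le_iff_right]
      refine hFE.trans_eq ?_
      push_cast
      ring
    obtain ⟨P, Q, hP, hQ, hPF, hQE, hPQ, hcov⟩ := ih (F \ G) (hF.diff hG) hrest
    refine ⟨fun i => i.casesOn G P, fun i => i.casesOn E Q, ?_, ?_, ?_, ?_, ?_, ?_⟩
    · rintro (_ | i); exacts [hG, hP i]
    · rintro (_ | i); exacts [hE, hQ i]
    · rintro (_ | i); exacts [hGF, (hPF i).trans Set.sdiff_subset]
    · rintro (_ | i); exacts [subset_rfl, hQE i]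
    · rintro (_ | i); exacts [hμG, hPQ i]
    · intro x hx
      by_cases hxG : x ∈ G
      · exact ⟨0, by omega, hxG⟩
      · obtain ⟨i, hi, hxi⟩ := hcov x ⟨hx, hxG⟩
        exact ⟨i + 1, by omega, hxi⟩

/-! ### Distributions of step functions -/

lemma measurable_stepFunction {Y : Finset ℝ≥0∞} {A : ℝ≥0∞ → Set α}
    (hA : ∀ y ∈ Y, MeasurableSet (A y)) : Measurable (stepFunction Y A) :=
  Finset.measurable_fun_sum Y fun y hy => measurable_const.indicator (hA y hy)

/-- Only the measures of the `A y` enter, so replacing them by sets of equal measure gives an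
equimeasurable function. The role of `s` is to force the `A y` to be disjoint. -/
lemma distribution_stepFunction {Y : Finset ℝ≥0∞} {A : ℝ≥0∞ → Set α} {s : α → ℝ≥0∞}
    (hA : ∀ y ∈ Y, MeasurableSet (A y)) (hs : ∀ y ∈ Y, ∀ x ∈ A y, s x = y) (t : ℝ≥0) :
    distribution μ (stepFunction Y A) t = ∑ y ∈ Y with (t : ℝ≥0∞) < y, μ (A y) := by
  have hset : {x | (t : ℝ≥0∞) < stepFunction Y A x} =
      ⋃ y ∈ Y.filter (fun y => (t : ℝ≥0∞) < y), A y := by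
    ext x
    simp only [Set.mem_ofPred_eq, Set.mem_iUnion, Finset.mem_filter, exists_prop]
    constructor
    · intro hx
      by_cases h : ∃ y ∈ Y, x ∈ A y
      · obtain ⟨y, hy, hxy⟩ := h
        rw [stepFunction_of_mem hs hy hxy] at hx
        exact ⟨y, ⟨hy, hx⟩, hxy⟩
      · push Not at h
        simp [stepFunction_of_notMem h] at hx
    · rintro ⟨y, ⟨hy, hty⟩, hxy⟩
      rwa [stepFunction_of_mem hs hy hxy]
  unfold distribution
  rw [hset, measure_biUnion_finset]
  · intro y hy z hz hyz
    simp only [Finset.coe_filter, Set.mem_ofPred_eq] at hy hz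
    refine Set.disjoint_left.2 fun x hx hx' => hyz ?_
    rw [← hs y hy.1 x hx, hs z hz.1 x hx']
  · exact fun y hy => hA y (Finset.mem_filter.1 hy).1

/-! ### Boundedness of composition operators -/

namespace IsRIQuasiBanachFunctionNorm

variable {ρ : (α → ℝ≥0∞) → ℝ≥0∞}

lemma congr_ae (hρ : IsRIQuasiBanachFunctionNorm μ ρ) {f g : α → ℝ≥0∞} (hf : Measurable f)
    (hg : Measurable g) (h : f =ᵐ[μ] g) : ρ f = ρ g :=
  le_antisymm (hρ.mono f g hf hg h.le) (hρ.mono g f hg hf h.symm.le)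

/-- The constant is chosen before the functions, so it will serve all iterates of `φ` at once. -/
lemma exists_sum_le (hρ : IsRIQuasiBanachFunctionNorm μ ρ) (M : ℕ) :
    ∃ K : ℝ≥0, ∀ (g : ℕ → α → ℝ≥0∞) (r : ℝ≥0∞), (∀ i, Measurable (g i)) → (∀ i, ρ (g i) ≤ r) →
      ρ (fun x => ∑ i ∈ Finset.range M, g i x) ≤ K * r := by
  obtain ⟨C, -, hC⟩ := hρ.quasi_subadditive
  induction M with
  | zero =>
    refine ⟨0, fun g r _ _ => ?_⟩
    have : ρ (fun _ => 0) = 0 := (hρ.eq_zero_iff _ measurable_const).2 ae_eq_rfl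
    simp [this]
  | succ M ih =>
    obtain ⟨K, hK⟩ := ih
    refine ⟨C * (K + 1), fun g r hg hr => ?_⟩
    simp only [Finset.sum_range_succ]
    refine (hC _ _ (Finset.measurable_fun_sum _ fun i _ => hg i) (hg M)).trans ?_
    calc (C : ℝ≥0∞) * (ρ (fun x => ∑ i ∈ Finset.range M, g i x) + ρ (g M))
        ≤ C * (K * r + r) := by gcongr; exacts [hK g r hg hr, hr M]
      _ = (C * (K + 1) : ℝ≥0) * r := by push_cast; ring

/-- Composition with maps `ψ` satisfying `μ (ψ⁻¹ E) ≤ (N + 1) μ E` is bounded on simple functions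
of finite support, uniformly in `ψ`. -/
lemma exists_simpleFunc_comp_le (hρ : IsRIQuasiBanachFunctionNorm μ ρ) (hμ : Resonant μ) (N : ℕ) :
    ∃ K : ℝ≥0, ∀ ψ : α → α, Measurable ψ →
      (∀ E, MeasurableSet E → μ (ψ ⁻¹' E) ≤ (N + 1 : ℕ) * μ E) →
      ∀ s : SimpleFunc α ℝ≥0∞, (∀ y ≠ 0, μ (s ⁻¹' {y}) ≠ ∞) → ρ (s ∘ ψ) ≤ K * ρ s := by
  obtain ⟨K, hK⟩ := hρ.exists_sum_le (N + 1)
  refine ⟨K, fun ψ hψ hbound s hs => ?_⟩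
  -- The value 0 is left out: its level set may have infinite measure and contributes nothing.
  let Y : Finset ℝ≥0∞ := s.range.filter (· ≠ 0)
  have hpieces : ∀ y : ℝ≥0∞, ∃ P Q : ℕ → Set α, y ≠ 0 →
      (∀ i, MeasurableSet (P i)) ∧ (∀ i, MeasurableSet (Q i)) ∧
      (∀ i, P i ⊆ ψ ⁻¹' (s ⁻¹' {y})) ∧ (∀ i, Q i ⊆ s ⁻¹' {y}) ∧ (∀ i, μ (P i) = μ (Q i)) ∧
      ∀ x ∈ ψ ⁻¹' (s ⁻¹' {y}), ∃ i < N + 1, x ∈ P i := by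
    intro y
    by_cases hy : y = 0
    · exact ⟨fun _ => ∅, fun _ => ∅, fun h => absurd hy h⟩
    · have hm := s.measurableSet_fiber y
      obtain ⟨P, Q, h⟩ := hμ.exists_pieces hm (hs y hy) N _ (hψ hm) (hbound _ hm)
      exact ⟨P, Q, fun _ => h⟩
  choose P Q hPQ using hpieces
  have hY : ∀ y ∈ Y, y ≠ 0 := fun y hy => (Finset.mem_filter.1 hy).2
  have hPm : ∀ i, ∀ y ∈ Y, MeasurableSet (P y i) := fun i y hy => (hPQ y (hY y hy)).1 i
  have hQm : ∀ i, ∀ y ∈ Y, MeasurableSet (Q y i) := fun i y hy => (hPQ y (hY y hy)).2.1 i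
  have hPs : ∀ i, ∀ y ∈ Y, ∀ x ∈ P y i, (s ∘ ψ) x = y :=
    fun i y hy x hx => (hPQ y (hY y hy)).2.2.1 i hx
  have hQs : ∀ i, ∀ y ∈ Y, ∀ x ∈ Q y i, s x = y :=
    fun i y hy x hx => (hPQ y (hY y hy)).2.2.2.1 i hx
  -- `g i` carries each value `y` on the `i`-th piece of its level set; moving the pieces `P y i` to
  -- `Q y i` turns it into a function below `s`.
  let g : ℕ → α → ℝ≥0∞ := fun i => stepFunction Y fun y => P y i
  have hg : ∀ i, Measurable (g i) := fun i => measurable_stepFunction (hPm i)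
  have hgρ : ∀ i, ρ (g i) ≤ ρ s := by
    intro i
    have hfm : Measurable (stepFunction Y fun y => Q y i) := measurable_stepFunction (hQm i)
    have heq : Equimeasurable μ (g i) (stepFunction Y fun y => Q y i) := by
      rw [equimeasurable_iff]
      intro t
      rw [distribution_stepFunction (hPm i) (hPs i), distribution_stepFunction (hQm i) (hQs i)]
      exact Finset.sum_congr rfl fun y hy =>
        (hPQ y (hY y (Finset.mem_filter.1 hy).1)).2.2.2.2.1 i
    rw [hρ.rearrangement_invariant _ _ (hg i) hfm heq]
    exact hρ.mono _ _ hfm s.measurable (ae_of_all _ (stepFunction_le (hQs i)))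
  refine le_trans ?_ (hK g (ρ s) hg hgρ)
  refine hρ.mono _ _ (s.measurable.comp hψ) (Finset.measurable_fun_sum _ fun i _ => hg i)
    (ae_of_all _ fun x => ?_)
  by_cases hx : s (ψ x) = 0
  · simp [hx]
  · have hxY : s (ψ x) ∈ Y := Finset.mem_filter.2 ⟨s.mem_range_self _, hx⟩
    obtain ⟨i, hi, hxi⟩ := (hPQ _ hx).2.2.2.2.2 x rfl
    calc (s ∘ ψ) x = g i x := (stepFunction_of_mem (hPs i) hxY hxi).symm
      _ ≤ ∑ i ∈ Finset.range (N + 1), g i x :=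
        Finset.single_le_sum (f := fun i => g i x) (fun _ _ => zero_le) (Finset.mem_range.2 hi)

lemma exists_comp_le [SigmaFinite μ] (hρ : IsRIQuasiBanachFunctionNorm μ ρ) (hμ : Resonant μ)
    (N : ℕ) :
    ∃ K : ℝ≥0, ∀ ψ : α → α, Measurable ψ →
      (∀ E, MeasurableSet E → μ (ψ ⁻¹' E) ≤ (N + 1 : ℕ) * μ E) →
      ∀ f : α → ℝ≥0∞, Measurable f → ρ (f ∘ ψ) ≤ K * ρ f := by
  obtain ⟨K, hK⟩ := hρ.exists_simpleFunc_comp_le hμ N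
  refine ⟨K, fun ψ hψ hbound f hf => ?_⟩
  -- Restriction to the spanning sets gives the nonzero level sets finite measure.
  let s : ℕ → SimpleFunc α ℝ≥0∞ := fun n => (SimpleFunc.eapprox f n).restrict (spanningSets μ n)
  have hs : ∀ n x, s n x = (spanningSets μ n).indicator (SimpleFunc.eapprox f n) x := fun n x =>
    SimpleFunc.restrict_apply _ (measurableSet_spanningSets μ n) x
  have hmono : ∀ x, Monotone fun n => s n x := by
    intro x m n hmn
    simp only [hs]
    exact (Set.indicator_le_indicator (SimpleFunc.monotone_eapprox f hmn x)).trans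
      (Set.indicator_le_indicator_of_subset (monotone_spanningSets μ hmn) (fun _ => zero_le) x)
  have htend : ∀ x, Tendsto (fun n => s n x) atTop (𝓝 (f x)) := by
    intro x
    refine (SimpleFunc.tendsto_eapprox hf x).congr' ?_
    obtain ⟨n₀, hn₀⟩ : ∃ n, x ∈ spanningSets μ n := by
      simp [← Set.mem_iUnion, iUnion_spanningSets]
    filter_upwards [eventually_ge_atTop n₀] with n hn
    rw [hs, Set.indicator_of_mem (monotone_spanningSets μ hn hn₀)]
  have hle : ∀ n, ρ (s n) ≤ ρ f := fun n =>
    hρ.mono _ _ (s n).measurable hf (ae_of_all _ fun x => (hmono x).ge_of_tendsto (htend x) n)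
  have hfin : ∀ n, ∀ y ≠ 0, μ (s n ⁻¹' {y}) ≠ ∞ := by
    intro n y hy
    refine ((measure_mono fun x hx => ?_).trans_lt (measure_spanningSets_lt_top μ n)).ne
    by_contra hxn
    have hx' : s n x = y := hx
    rw [hs, Set.indicator_of_notMem hxn] at hx'
    exact hy hx'.symm
  have hlim := hρ.fatou (fun n => s n ∘ ψ) (f ∘ ψ) (fun n => (s n).measurable.comp hψ)
    (hf.comp hψ) (ae_of_all _ fun x => ⟨hmono (ψ x), htend (ψ x)⟩)
  refine le_of_tendsto' hlim fun n => (hK ψ hψ hbound (s n) (hfin n)).trans ?_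
  gcongr
  exact hle n

end IsRIQuasiBanachFunctionNorm

/-! ### Iterates of composition operators -/

lemma IsCompositionOperator.iterate {ρ : (α → ℝ≥0∞) → ℝ≥0∞} {φ : α → α}
    {T : space μ ρ → space μ ρ} (hT : IsCompositionOperator μ ρ φ T) (hφ : Measurable φ)
    (F : space μ ρ) {f : α → ℂ} (hf : Measurable f) (hFf : (F : α →ₘ[μ] ℂ) =ᵐ[μ] f) (n : ℕ) :
    (T^[n] F : α →ₘ[μ] ℂ) =ᵐ[μ] f ∘ φ^[n] := by
  induction n with
  | zero => simpa using hFf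
  | succ n ih =>
    rw [Function.iterate_succ_apply', Function.iterate_succ]
    exact hT _ _ (hf.comp (hφ.iterate n)) ih

lemma measurable_enorm_coeFn (f : α →ₘ[μ] ℂ) : Measurable fun x => ‖f x‖ₑ :=
  f.measurable.enorm

lemma compositionPowerBounded_of_powerMeasureBounded [SigmaFinite μ] (hμ : Resonant μ) {φ : α → α}
    (hφ : Measurable φ) (h : PowerMeasureBounded μ φ) {ρ : (α → ℝ≥0∞) → ℝ≥0∞}
    (hρ : IsRIQuasiBanachFunctionNorm μ ρ) : CompositionPowerBounded μ ρ φ := by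
  obtain ⟨A, -, hA⟩ := h
  obtain ⟨N, hN⟩ := exists_nat_ge A
  -- The bound `N + 1 ≥ 1` also covers `n = 0`, which `PowerBounded` includes.
  have hbound : ∀ n E, MeasurableSet E → μ (φ^[n] ⁻¹' E) ≤ (N + 1 : ℕ) * μ E := by
    intro n E hE
    rcases Nat.eq_zero_or_pos n with rfl | hn
    · calc μ (φ^[0] ⁻¹' E) = 1 * μ E := by simp
        _ ≤ (N + 1 : ℕ) * μ E := by gcongr; simp
    · refine (hA n hn E hE).trans ?_
      gcongr
      calc (A : ℝ≥0∞) ≤ (N : ℝ≥0) := by exact_mod_cast hN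
        _ ≤ (N + 1 : ℕ) := by push_cast; exact le_self_add
  have hqmp : Measure.QuasiMeasurePreserving φ μ μ := by
    refine ⟨hφ, Measure.AbsolutelyContinuous.mk fun E hE hE0 => ?_⟩
    rw [Measure.map_apply hφ hE]
    simpa [hE0] using hbound 1 E hE
  obtain ⟨K, hK⟩ := hρ.exists_comp_le hμ N
  have hcomp : ∀ (n : ℕ) (F G : α →ₘ[μ] ℂ), G =ᵐ[μ] F ∘ φ^[n] → fnorm ρ G ≤ K * fnorm ρ F := by
    intro n F G hG
    have hm := measurable_enorm_coeFn F
    refine le_trans (le_of_eq ?_) (hK _ (hφ.iterate n) (hbound n) _ hm)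
    refine hρ.congr_ae (measurable_enorm_coeFn G) (hm.comp (hφ.iterate n)) ?_
    filter_upwards [hG] with x hx
    simp [hx]
  let T : space μ ρ → space μ ρ := fun F =>
    ⟨(F : α →ₘ[μ] ℂ).compQuasiMeasurePreserving φ hqmp,
      (hcomp 1 F _ (by simpa using AEEqFun.coeFn_compQuasiMeasurePreserving _ hqmp)).trans_lt
        (ENNReal.mul_lt_top ENNReal.coe_lt_top F.2)⟩
  have hT : IsCompositionOperator μ ρ φ T := fun F f _ hFf =>
    (AEEqFun.coeFn_compQuasiMeasurePreserving _ hqmp).trans (hqmp.ae_eq_comp hFf)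
  refine ⟨T, hT, fun f ε hε => ⟨ε / (K + 1), ?_, fun g hg n => ?_⟩⟩
  · exact ENNReal.div_pos hε.ne' (by finiteness)
  · have hae : ((T^[n] g : α →ₘ[μ] ℂ) - (T^[n] f : α →ₘ[μ] ℂ) : α →ₘ[μ] ℂ) =ᵐ[μ]
        ((g : α →ₘ[μ] ℂ) - (f : α →ₘ[μ] ℂ) : α →ₘ[μ] ℂ) ∘ φ^[n] := by
      have hq : Measure.QuasiMeasurePreserving φ^[n] μ μ := hqmp.iterate n
      filter_upwards [AEEqFun.coeFn_sub (T^[n] g : α →ₘ[μ] ℂ) (T^[n] f : α →ₘ[μ] ℂ),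
        hq.ae_eq_comp (AEEqFun.coeFn_sub (g : α →ₘ[μ] ℂ) (f : α →ₘ[μ] ℂ)),
        hT.iterate hφ g (AEEqFun.measurable _) ae_eq_rfl n,
        hT.iterate hφ f (AEEqFun.measurable _) ae_eq_rfl n] with x h1 h2 h3 h4
      rw [h1, h2, Pi.sub_apply, h3, h4]
      rfl
    calc fnorm ρ ((T^[n] g : α →ₘ[μ] ℂ) - (T^[n] f : α →ₘ[μ] ℂ))
        ≤ K * fnorm ρ ((g : α →ₘ[μ] ℂ) - (f : α →ₘ[μ] ℂ)) := hcomp n _ _ hae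
      _ ≤ (K + 1) * fnorm ρ ((g : α →ₘ[μ] ℂ) - (f : α →ₘ[μ] ℂ)) := by gcongr; exact le_self_add
      _ < ε := ENNReal.mul_lt_of_lt_div' hg

/-! ### The space `L¹` -/

/-- Functions equimeasurable with 1 are at most 1 almost everywhere, so the supremum in resonance is
attained at 1. -/
lemma Resonant.lintegral_eq (hμ : Resonant μ) {f : α → ℝ≥0∞} (hf : Measurable f) :
    ∫⁻ x, f x ∂μ = ∫⁻ t in Set.Ici (0 : ℝ), rearrangement μ f t.toNNReal *
      rearrangement μ (Set.univ.indicator fun _ : α => 1) t.toNNReal := by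
  have hm : Measurable (Set.univ.indicator fun _ : α => (1 : ℝ≥0∞)) :=
    measurable_const.indicator MeasurableSet.univ
  rw [← hμ f _ hf hm]
  refine le_antisymm ?_ (iSup_le fun h => iSup_le fun _ => iSup_le fun heq => ?_)
  · refine le_trans (le_of_eq ?_) (le_iSup_of_le (Set.univ.indicator fun _ : α => (1 : ℝ≥0∞))
      (le_iSup_of_le hm (le_iSup_of_le rfl le_rfl)))
    simp
  · refine lintegral_mono_ae ?_
    filter_upwards [heq.of_indicator_one.2] with x hx
    exact mul_le_of_le_one_right' hx

lemma isRIQuasiBanachFunctionNorm_L1norm (hμ : Resonant μ) :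
    IsRIQuasiBanachFunctionNorm μ (L1norm μ) where
  homogeneous a f hf := lintegral_const_mul _ hf
  eq_zero_iff f hf := lintegral_eq_zero_iff hf
  quasi_subadditive := ⟨1, le_rfl, fun f g hf _ => by
    simp [L1norm, lintegral_add_left hf]⟩
  mono f g _ _ h := lintegral_mono_ae h
  fatou F f hF _ h := lintegral_tendsto_of_tendsto_of_monotone (fun n => (hF n).aemeasurable)
    (h.mono fun _ hx => hx.1) (h.mono fun _ hx => hx.2)
  indicator_lt_top E hE h := by
    have : L1norm μ (E.indicator fun _ => 1) = μ E := lintegral_indicator_one hE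
    rwa [this]
  rearrangement_invariant f g hf hg h := by
    have h' : rearrangement μ f = rearrangement μ g := h
    simp only [L1norm, hμ.lintegral_eq hf, hμ.lintegral_eq hg, h']

lemma powerMeasureBounded_of_L1 {φ : α → α} (hφ : Measurable φ)
    (h : CompositionPowerBounded μ (L1norm μ) φ) : PowerMeasureBounded μ φ := by
  obtain ⟨T, hT, hpb⟩ := h
  have hnorm : ∀ {F : α →ₘ[μ] ℂ} {f : α → ℂ}, F =ᵐ[μ] f →
      fnorm (L1norm μ) F = ∫⁻ x, ‖f x‖ₑ ∂μ := fun hFf =>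
    lintegral_congr_ae (hFf.mono fun x hx => by simp [hx])
  have hzero : fnorm (L1norm μ) (0 : α →ₘ[μ] ℂ) = 0 := by
    simp [hnorm (AEEqFun.coeFn_zero (μ := μ) (β := ℂ))]
  obtain ⟨δ, hδ, hδε⟩ := hpb ⟨0, by simp [space, hzero]⟩ 1 one_pos
  -- Since `δ` may be infinite, a finite positive `d` below it is used.
  obtain ⟨d, hd0, hdδ⟩ := ENNReal.lt_iff_exists_nnreal_btwn.1 hδ
  have hd : d ≠ 0 := by simpa using hd0.ne'
  have key : ∀ (c : ℝ≥0) (E : Set α), MeasurableSet E → c * μ E ≤ d → ∀ n,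
      c * μ (φ^[n] ⁻¹' E) ≤ 1 := by
    intro c E hE hcE n
    let f : α → ℂ := E.indicator fun _ => (c : ℂ)
    have hf : Measurable f := measurable_const.indicator hE
    have hmeas : ∀ ψ : α → α, Measurable ψ → ∫⁻ x, ‖(f ∘ ψ) x‖ₑ ∂μ = c * μ (ψ ⁻¹' E) := by
      intro ψ hψ
      rw [← lintegral_indicator_const (hψ hE)]
      refine lintegral_congr fun x => ?_
      by_cases hx : ψ x ∈ E
      · simp [f, hx, enorm_eq_nnnorm]
      · simp [f, hx]
    have hFf := AEEqFun.coeFn_mk f (hf.aestronglyMeasurable (μ := μ))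
    have hFnorm : fnorm (L1norm μ) (AEEqFun.mk f (hf.aestronglyMeasurable (μ := μ))) = c * μ E :=
      (hnorm hFf).trans (hmeas id measurable_id)
    let F : space μ (L1norm μ) := ⟨AEEqFun.mk f hf.aestronglyMeasurable,
      (hFnorm.trans_le hcE).trans_lt ENNReal.coe_lt_top⟩
    have hlt := hδε F (by simpa [F, hFnorm] using hcE.trans_lt hdδ) n
    have h0 := hT.iterate hφ ⟨0, by simp [space, hzero]⟩ (f := 0) measurable_zero
      AEEqFun.coeFn_zero n
    have hF := hT.iterate hφ F hf hFf n
    rw [hnorm (f := f ∘ φ^[n]), hmeas _ (hφ.iterate n)] at hlt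
    · exact hlt.le
    · filter_upwards [AEEqFun.coeFn_sub (T^[n] F : α →ₘ[μ] ℂ)
        (T^[n] ⟨0, by simp [space, hzero]⟩ : space μ (L1norm μ)), h0, hF] with x h1 h2 h3
      rw [h1, Pi.sub_apply, h2, h3]
      simp
  -- For `0 < μ E < ∞`, taking `c = d / μ E` in `key` gives `μ (φ^[n] ⁻¹' E) ≤ μ E / d`.
  refine ⟨d⁻¹, inv_pos.2 (pos_iff_ne_zero.2 hd), fun n _ E hE => ?_⟩
  rcases eq_or_ne (μ E) ∞ with htop | htop
  · rw [htop, ENNReal.mul_top (by simpa using hd)]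
    exact le_top
  rcases eq_or_ne (μ E) 0 with h0 | h0
  -- For a null set every `c` is admissible in `key`, which forces a null preimage.
  · suffices μ (φ^[n] ⁻¹' E) = 0 by simp [this]
    by_contra hne
    obtain ⟨c, hc⟩ := ENNReal.exists_nat_mul_gt hne ENNReal.one_ne_top
    exact absurd (key c E hE (by simp [h0]) n) (not_le.2 (by simpa using hc))
  · lift μ E to ℝ≥0 using htop with m hm
    have hm0 : m ≠ 0 := by simpa using h0
    have := key (d / m) E hE (by rw [← hm, ← ENNReal.coe_mul, div_mul_cancel₀ _ hm0]) n
    have hk : ((d / m : ℝ≥0) : ℝ≥0∞) ≠ 0 := by simpa using ⟨hd, hm0⟩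
    rw [mul_comm, ← ENNReal.le_div_iff_mul_le (Or.inl hk) (Or.inl ENNReal.coe_ne_top)] at this
    refine this.trans_eq ?_
    rw [one_div, ← ENNReal.coe_inv (by positivity), ← ENNReal.coe_mul, inv_div, div_eq_inv_mul]

end RISpace

theorem mainTheorem5 {α : Type*} [MeasurableSpace α] (μ : MeasureTheory.Measure α)
    [MeasureTheory.SigmaFinite μ] (hμ : RISpace.Resonant μ) (φ : α → α) (hφ : Measurable φ) :
    List.TFAE
      [RISpace.PowerMeasureBounded μ φ,
       RISpace.CompositionPowerBounded μ (RISpace.L1norm μ) φ,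
       ∀ ρ : (α → ℝ≥0∞) → ℝ≥0∞, RISpace.IsRIQuasiBanachFunctionNorm μ ρ →
         RISpace.CompositionPowerBounded μ ρ φ] := by
  tfae_have 1 → 3 := fun h _ hρ =>
    RISpace.compositionPowerBounded_of_powerMeasureBounded hμ hφ h hρ
  tfae_have 3 → 2 := fun h => h _ (RISpace.isRIQuasiBanachFunctionNorm_L1norm hμ)
  tfae_have 2 → 1 := RISpace.powerMeasureBounded_of_L1 hφ
  tfae_finish
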